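/- Let $I$ be a set (possibly empty, finite, or of arbitrary infinite cardinality), and let $\{d_i\}_{i\in I}$ be a family of real numbers in $[0,1]$ such that $$a=\sum_{i\in I,\ d_i<1/2} d_i<\infty,\qquad b=\sum_{i\in I,\ d_i\ge 1/2}(1-d_i)<\infty,\qquad a-b\in\mathbb Z .$$ Let $\mathcal H$ be a real or complex Hilbert space with an orthonormal basis $\{e_i\}_{i\in I}$ indexed by $I$. Then there exists an orthogonal projection $P$ on $\mathcal H$ (a bounded linear operator with $P^2=P=P^*$) with diagonal $\{d_i\}_{i\in I}$ with respect to this basis, that is, $\langle Pe_i,e_i\rangle=d_i$ for all $i\in I$. -/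

import Mathlib

/-- The bounded operator `P` has diagonal `d` with respect to the orthonormal basis `e`:
`⟨P eᵢ, eᵢ⟩ = dᵢ` for every index `i`. -/
def HasDiagonal {𝕜 : Type*} [RCLike 𝕜] {I : Type*} {H : Type*} [NormedAddCommGroup H]
    [InnerProductSpace 𝕜 H] (e : HilbertBasis I 𝕜 H) (P : H →L[𝕜] H) (d : I → ℝ) : Prop :=
  ∀ i, inner 𝕜 (P (e i)) (e i) = (d i : 𝕜)

open Filter Topology Finset

/-! If all but finitely many entries are `0` or `1` and the exceptional ones have integral sum,
plane reflections make them integral one at a time (`exists_projection_of_finset`). In general, keep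
`d` on a finite set `F`, round it to `{0,1}` elsewhere, and adjust one entry lying strictly between
`0` and `1` so that the sum over `F` is an integer; since `a - b` is an integer, the adjustment
tends to `0`. A weak limit of projections need not be a projection. Here the summable distances to
`{0,1}` dominate the squared entries of each column, so the relations `⟨P eᵢ, P eₖ⟩ = ⟨P eᵢ, eₖ⟩`
pass to the limit (`exists_projection_of_tendsto`). -/

section Projections

variable {𝕜 : Type*} [RCLike 𝕜] {I : Type*} {H : Type*} [NormedAddCommGroup H]
    [InnerProductSpace 𝕜 H]

/-! ### Matrix entries of projections -/

/-- Vectors `v i` whose Gram matrix agrees with their coordinates in the basis `e` are the images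
of the basis vectors under an orthogonal projection. -/
theorem exists_isStarProjection_of_gram [CompleteSpace H] (e : HilbertBasis I 𝕜 H) (v : I → H)
    (hv : ∀ i k, inner 𝕜 (v i) (v k) = inner 𝕜 (e i) (v k)) :
    ∃ P : H →L[𝕜] H, IsStarProjection P ∧ ∀ k, P (e k) = v k := by
  set M : Submodule 𝕜 H := (Submodule.span 𝕜 (Set.range v)).topologicalClosure with hM
  have : CompleteSpace M :=
    (Submodule.isClosed_topologicalClosure (Submodule.span 𝕜 (Set.range v))).completeSpace_coe
  have hvM : ∀ k, v k ∈ M := fun k =>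
    Submodule.le_topologicalClosure _ (Submodule.subset_span ⟨k, rfl⟩)
  refine ⟨M.starProjection, isStarProjection_starProjection, fun k => ?_⟩
  refine Submodule.eq_starProjection_of_mem_orthogonal (hvM k) ?_
  rw [hM, Submodule.orthogonal_closure, Submodule.mem_orthogonal]
  intro u hu
  induction hu using Submodule.span_induction with
  | mem x hx =>
    obtain ⟨i, rfl⟩ := hx
    rw [inner_sub_right, ← inner_conj_symm (v i) (e k), ← hv k i, inner_conj_symm, sub_self]
  | zero => simp
  | add x y _ _ hx hy => rw [inner_add_left, hx, hy, add_zero]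
  | smul c x _ hx => rw [inner_smul_left, hx, mul_zero]

theorem IsStarProjection.inner_apply_eq [CompleteSpace H] {P : H →L[𝕜] H}
    (hP : IsStarProjection P) (x y : H) : inner 𝕜 (P x) y = inner 𝕜 (P x) (P y) := by
  have h : P (P x) = P x := congrArg (fun T : H →L[𝕜] H => T x) hP.isIdempotentElem
  have h2 := (ContinuousLinearMap.isSelfAdjoint_iff_isSymmetric.1 hP.isSelfAdjoint) (P x) y
  simpa only [ContinuousLinearMap.coe_coe, h] using h2

theorem IsStarProjection.norm_apply_sq [CompleteSpace H] {P : H →L[𝕜] H}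
    (hP : IsStarProjection P) {x : H} {r : ℝ} (h : inner 𝕜 (P x) x = (r : 𝕜)) :
    ‖P x‖ ^ 2 = r := by
  rw [hP.inner_apply_eq, inner_self_eq_norm_sq_to_K] at h
  exact_mod_cast h

/-- Cauchy–Schwarz for `⟨P y, P x⟩`, with `‖P x‖ ≤ 1` and `‖P y‖ ^ 2 = r`. -/
theorem IsStarProjection.norm_inner_sq_le [CompleteSpace H] {P : H →L[𝕜] H}
    (hP : IsStarProjection P) {x y : H} {r : ℝ} (h : inner 𝕜 (P y) y = (r : 𝕜)) (hx : ‖x‖ = 1) :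
    ‖(inner 𝕜 y (P x) : 𝕜)‖ ^ 2 ≤ r := by
  have h1 : ‖P x‖ ≤ 1 := by
    have h2 := norm_inner_le_norm (𝕜 := 𝕜) (P x) x
    rw [hP.inner_apply_eq, inner_self_eq_norm_sq_to_K, hx, mul_one] at h2
    have h3 : ‖P x‖ ^ 2 ≤ ‖P x‖ := by simpa using h2
    nlinarith [norm_nonneg (P x)]
  have h4 : ‖(inner 𝕜 y (P x) : 𝕜)‖ ≤ ‖P y‖ := by
    rw [← norm_inner_symm, hP.inner_apply_eq]
    calc _ ≤ ‖P x‖ * ‖P y‖ := norm_inner_le_norm _ _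
      _ ≤ 1 * ‖P y‖ := by gcongr
      _ = _ := one_mul _
  rw [← hP.norm_apply_sq h]
  gcongr

/-- An off-diagonal entry of a projection is bounded by the distance of the diagonal entry in its
row to either `0` or `1`. -/
theorem HasDiagonal.norm_entry_sq_le [CompleteSpace H] {e : HilbertBasis I 𝕜 H} {P : H →L[𝕜] H}
    (hP : IsStarProjection P) {d : I → ℝ} (hd : HasDiagonal e P d) {i j : I} (hij : j ≠ i)
    {C : ℝ} (hC : d j ≤ C ∨ 1 - d j ≤ C) : ‖(inner 𝕜 (e j) (P (e i)) : 𝕜)‖ ^ 2 ≤ C := by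
  have hi : ‖e i‖ = 1 := e.orthonormal.1 i
  rcases hC with hC | hC
  · exact (hP.norm_inner_sq_le (hd j) hi).trans hC
  · refine le_trans ?_ hC
    -- The complementary projection has the same off-diagonal entries up to sign.
    have h1 : inner 𝕜 ((1 - P) (e j)) (e j) = ((1 - d j : ℝ) : 𝕜) := by
      simp [inner_sub_left, hd j, inner_self_eq_norm_sq_to_K, e.orthonormal.1 j]
    have h2 := hP.one_sub.norm_inner_sq_le h1 hi
    simpa [inner_sub_right, e.orthonormal.2 hij] using h2

/-- `‖P (e j)‖ ^ 2 = d j` settles the value `0`; the value `1` is the same argument for `1 - P`. -/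
theorem HasDiagonal.apply_eq_smul [CompleteSpace H] {e : HilbertBasis I 𝕜 H} {P : H →L[𝕜] H}
    (hP : IsStarProjection P) {d : I → ℝ} (hd : HasDiagonal e P d) {j : I}
    (hj : d j = 0 ∨ d j = 1) : P (e j) = (d j : 𝕜) • e j := by
  rcases hj with hj | hj
  · have := hP.norm_apply_sq (hd j)
    rw [hj] at this ⊢
    simpa using this
  · have h1 : inner 𝕜 ((1 - P) (e j)) (e j) = ((1 - d j : ℝ) : 𝕜) := by
      simp [inner_sub_left, hd j, inner_self_eq_norm_sq_to_K, e.orthonormal.1 j]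
    have := hP.one_sub.norm_apply_sq h1
    rw [hj] at this ⊢
    simp [sub_eq_zero] at this ⊢
    exact this.symm

theorem exists_projection_of_zero_one [CompleteSpace H] (e : HilbertBasis I 𝕜 H) (d : I → ℝ)
    (hd : ∀ i, d i = 0 ∨ d i = 1) :
    ∃ P : H →L[𝕜] H, IsStarProjection P ∧ HasDiagonal e P d := by
  obtain ⟨P, hP, h⟩ := exists_isStarProjection_of_gram e (fun k => (d k : 𝕜) • e k) (by
    classical
    intro i k
    simp only [inner_smul_left, inner_smul_right, RCLike.conj_ofReal,
      orthonormal_iff_ite.1 e.orthonormal]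
    split_ifs with hik
    · subst hik
      rcases hd i with h | h <;> simp [h]
    · simp)
  refine ⟨P, hP, fun i => ?_⟩
  simp [h, inner_smul_left, inner_self_eq_norm_sq_to_K, e.orthonormal.1 i]

/-! ### The finite case, by plane reflections -/

/-- An orthonormal basis obtained by reflecting two vectors of a given one within their plane. -/
theorem HilbertBasis.exists_plane_reflection [CompleteSpace H] (e : HilbertBasis I 𝕜 H) {i j : I}
    (hij : i ≠ j) {c s : ℝ} (hcs : c ^ 2 + s ^ 2 = 1) :
    ∃ f : HilbertBasis I 𝕜 H, e i = (c : 𝕜) • f i + (s : 𝕜) • f j ∧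
      e j = (s : 𝕜) • f i - (c : 𝕜) • f j ∧ ∀ k, k ≠ i → k ≠ j → e k = f k := by
  classical
  set f : I → H := fun k => if k = i then (c : 𝕜) • e i + (s : 𝕜) • e j
    else if k = j then (s : 𝕜) • e i - (c : 𝕜) • e j else e k with hf
  have hK : (c : 𝕜) * c + (s : 𝕜) * s = 1 := by
    have : c * c + s * s = 1 := by linarith [hcs]
    exact_mod_cast this
  have hfi : f i = (c : 𝕜) • e i + (s : 𝕜) • e j := by simp [hf]
  have hfj : f j = (s : 𝕜) • e i - (c : 𝕜) • e j := by simp [hf, hij.symm]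
  have hfk : ∀ k, k ≠ i → k ≠ j → f k = e k := fun k h1 h2 => by simp [hf, h1, h2]
  have hei : e i = (c : 𝕜) • f i + (s : 𝕜) • f j := by
    rw [hfi, hfj]
    linear_combination (norm := module) (-hK) • e i
  have hej : e j = (s : 𝕜) • f i - (c : 𝕜) • f j := by
    rw [hfi, hfj]
    linear_combination (norm := module) (-hK) • e j
  have hon : Orthonormal 𝕜 f := by
    have he := orthonormal_iff_ite.1 e.orthonormal
    rw [orthonormal_iff_ite]
    intro k l
    by_cases hki : k = i
    · subst hki
      by_cases hli : l = k
      · subst hli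
        simp only [hfi, inner_add_left, inner_add_right, inner_smul_left, inner_smul_right, he,
          RCLike.conj_ofReal, if_true, if_neg hij, if_neg hij.symm]
        linear_combination hK
      by_cases hlj : l = j
      · subst hlj
        simp only [hfi, hfj, inner_add_left, inner_sub_right, inner_smul_left, inner_smul_right, he,
          RCLike.conj_ofReal, if_true, if_neg hij, if_neg hij.symm]
        ring
      · simp [hfi, hfk l hli hlj, inner_add_left, inner_smul_left, he, Ne.symm hli, Ne.symm hlj]
    by_cases hkj : k = j
    · subst hkj
      by_cases hli : l = i
      · subst hli
        simp only [hfi, hfj, inner_add_right, inner_sub_left, inner_smul_left, inner_smul_right, he,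
          RCLike.conj_ofReal, if_true, if_neg hij, if_neg hij.symm]
        ring
      by_cases hlj : l = k
      · subst hlj
        simp only [hfj, inner_sub_left, inner_sub_right, inner_smul_left, inner_smul_right, he,
          RCLike.conj_ofReal, if_true, if_neg hij, if_neg hij.symm]
        linear_combination hK
      · simp [hfj, hfk l hli hlj, inner_sub_left, inner_smul_left, he, Ne.symm hli, Ne.symm hlj]
    · by_cases hli : l = i
      · subst hli
        simp [hfi, hfk k hki hkj, inner_add_right, inner_smul_right, he, hki, hkj]
      by_cases hlj : l = j
      · subst hlj
        simp [hfj, hfk k hki hkj, inner_sub_right, inner_smul_right, he, hki, hkj]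
      · simp [hfk k hki hkj, hfk l hli hlj, he]
  have hspan : ⊤ ≤ (Submodule.span 𝕜 (Set.range f)).topologicalClosure := by
    rw [← e.dense_span]
    refine Submodule.topologicalClosure_mono (Submodule.span_le.2 ?_)
    have hmem : ∀ k, f k ∈ Submodule.span 𝕜 (Set.range f) := fun k =>
      Submodule.subset_span ⟨k, rfl⟩
    rintro _ ⟨k, rfl⟩
    rw [SetLike.mem_coe]
    by_cases hki : k = i
    · rw [hki, hei]
      exact add_mem (Submodule.smul_mem _ _ (hmem i)) (Submodule.smul_mem _ _ (hmem j))
    by_cases hkj : k = j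
    · rw [hkj, hej]
      exact sub_mem (Submodule.smul_mem _ _ (hmem i)) (Submodule.smul_mem _ _ (hmem j))
    · rw [← hfk k hki hkj]
      exact hmem k
  refine ⟨HilbertBasis.mk hon hspan, ?_, ?_, fun k hki hkj => ?_⟩
  · simpa using hei
  · simpa using hej
  · simp [hfk k hki hkj]

theorem exists_cos_sin_sq {w : ℝ} (h0 : 0 ≤ w) (h1 : w ≤ 1) :
    ∃ c s : ℝ, c ^ 2 = w ∧ s ^ 2 = 1 - w :=
  ⟨√w, √(1 - w), Real.sq_sqrt h0, Real.sq_sqrt (by linarith)⟩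

/-- A pair of diagonal entries in `[0,1]` is obtained by a plane reflection from a pair with the
same sum, one of whose entries is `0` or `1`. -/
theorem exists_plane_reflection_diagonal {x y : ℝ} (hx : x ∈ Set.Icc (0 : ℝ) 1)
    (hy : y ∈ Set.Icc (0 : ℝ) 1) :
    ∃ t z c s : ℝ, t ∈ Set.Icc (0 : ℝ) 1 ∧ (z = 0 ∨ z = 1) ∧ c ^ 2 + s ^ 2 = 1 ∧
      c ^ 2 * t + s ^ 2 * z = x ∧ s ^ 2 * t + c ^ 2 * z = y := by
  obtain ⟨hx0, hx1⟩ := hx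
  obtain ⟨hy0, hy1⟩ := hy
  rcases le_or_gt (x + y) 1 with h | h
  · obtain ⟨c, s, hc, hs⟩ := exists_cos_sin_sq (w := x / (x + y)) (by positivity)
      (div_le_one_of_le₀ (by linarith) (by linarith))
    -- If `x + y = 0`, the convention `0 / 0 = 0` gives `c = 0`, which still works.
    have hm : x / (x + y) * (x + y) = x := by
      rcases eq_or_ne (x + y) 0 with h0 | h0
      · rw [h0]; simp; linarith
      · exact div_mul_cancel₀ _ h0
    refine ⟨x + y, 0, c, s, ⟨by linarith, h⟩, Or.inl rfl, by rw [hc, hs]; ring, ?_, ?_⟩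
    · rw [hc]; linarith
    · rw [hs]; linarith
  -- The previous case applied to `1 - x` and `1 - y`.
  · obtain ⟨c, s, hc, hs⟩ := exists_cos_sin_sq (w := (1 - x) / (2 - x - y))
      (div_nonneg (by linarith) (by linarith))
      (div_le_one_of_le₀ (by linarith) (by linarith))
    have hm : (1 - x) / (2 - x - y) * (2 - x - y) = 1 - x := by
      rcases eq_or_ne (2 - x - y) 0 with h0 | h0
      · rw [h0]; simp; linarith
      · exact div_mul_cancel₀ _ h0
    refine ⟨x + y - 1, 1, c, s, ⟨by linarith, by linarith⟩, Or.inr rfl, by rw [hc, hs]; ring, ?_, ?_⟩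
    · rw [hc, hs]; linarith
    · rw [hc, hs]; linarith

/-- A family in `[0,1]` with values in `{0,1}` outside a finite set, whose sum over that set is an
integer, is the diagonal of a projection. -/
theorem exists_projection_of_finset [CompleteSpace H] (S : Finset I) (e : HilbertBasis I 𝕜 H)
    (d : I → ℝ) (hd : ∀ i, d i ∈ Set.Icc (0 : ℝ) 1) (hS : ∀ i, i ∉ S → d i = 0 ∨ d i = 1)
    (hn : ∃ n : ℤ, ∑ i ∈ S, d i = n) :
    ∃ P : H →L[𝕜] H, IsStarProjection P ∧ HasDiagonal e P d := by
  classical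
  induction S using Finset.induction_on generalizing e d with
  | empty => exact exists_projection_of_zero_one e d fun i => hS i (by simp)
  | insert j S hj ih =>
    obtain ⟨n, hn⟩ := hn
    rw [sum_insert hj] at hn
    rcases S.eq_empty_or_nonempty with rfl | ⟨i, hi⟩
    · refine exists_projection_of_zero_one e d fun k => ?_
      by_cases hk : k = j
      · subst hk
        rw [sum_empty, add_zero] at hn
        obtain ⟨h0, h1⟩ := hd k
        rw [hn] at h0 h1 ⊢
        have h0' : 0 ≤ n := by exact_mod_cast h0
        have h1' : n ≤ 1 := by exact_mod_cast h1
        have : n = 0 ∨ n = 1 := by omega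
        exact_mod_cast this
      · exact hS k (by simpa using hk)
    have hij : i ≠ j := fun h => hj (h ▸ hi)
    obtain ⟨t, z, c, s, ht, hz, hcs, hx, hy⟩ := exists_plane_reflection_diagonal (hd i) (hd j)
    obtain ⟨f, hei, hej, hek⟩ := e.exists_plane_reflection hij hcs
    -- The diagonal wanted in the basis `f`: its entry at `j` is `0` or `1`, so `j` leaves the
    -- exceptional set, and the sum over the rest stays integral.
    set d' : I → ℝ := fun k => if k = i then t else if k = j then z else d k with hd'
    have hd'i : d' i = t := by simp [hd']
    have hd'j : d' j = z := by simp [hd', hij.symm]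
    have hd'k : ∀ k, k ≠ i → k ≠ j → d' k = d k := fun k h1 h2 => by simp [hd', h1, h2]
    obtain ⟨P, hP, hdiag⟩ := ih f d'
      (fun k => by
        by_cases hki : k = i
        · rwa [hki, hd'i]
        by_cases hkj : k = j
        · rw [hkj, hd'j]
          rcases hz with rfl | rfl <;> simp
        · rw [hd'k k hki hkj]
          exact hd k)
      (fun k hk => by
        have hki : k ≠ i := fun h => hk (h ▸ hi)
        by_cases hkj : k = j
        · rwa [hkj, hd'j]
        · rw [hd'k k hki hkj]
          exact hS k (by simp [hk, hkj]))
      (by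
        obtain ⟨m, hm⟩ : ∃ m : ℤ, z = m := by
          rcases hz with rfl | rfl
          · exact ⟨0, by simp⟩
          · exact ⟨1, by simp⟩
        refine ⟨n - m, ?_⟩
        have h1 : ∑ k ∈ S.erase i, d' k = ∑ k ∈ S.erase i, d k :=
          sum_congr rfl fun k hk =>
            hd'k k (ne_of_mem_erase hk) fun h => hj (h ▸ mem_of_mem_erase hk)
        rw [← add_sum_erase S _ hi] at hn
        rw [← add_sum_erase S _ hi, h1, hd'i]
        push_cast
        rw [← hn, ← hm]
        linear_combination hx + hy - (t + z) * hcs)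
    -- As `f j` is an eigenvector, the cross terms vanish and the entries at `e i`, `e j` depend
    -- only on `t` and `z`.
    have hPj : P (f j) = (z : 𝕜) • f j := by
      rw [hdiag.apply_eq_smul hP (by rwa [hd'j]), hd'j]
    have hfij : inner 𝕜 (f i) (f j) = 0 := f.orthonormal.2 hij
    have hfji : inner 𝕜 (f j) (f i) = 0 := f.orthonormal.2 hij.symm
    have hfjj : inner 𝕜 (f j) (f j) = (1 : 𝕜) := by
      simp [inner_self_eq_norm_sq_to_K, f.orthonormal.1 j]
    have h12 : inner 𝕜 (P (f i)) (f j) = 0 := by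
      rw [hP.inner_apply_eq, ← inner_conj_symm, ← hP.inner_apply_eq, hPj, inner_smul_left, hfji]
      simp
    have h11 : inner 𝕜 (P (f i)) (f i) = (t : 𝕜) := by rw [hdiag i, hd'i]
    refine ⟨P, hP, fun k => ?_⟩
    by_cases hki : k = i
    · rw [hki, hei, ← hx]
      simp only [map_add, map_smul, hPj, inner_add_left, inner_add_right, inner_smul_left,
        inner_smul_right, h11, h12, hfji, hfjj, RCLike.conj_ofReal]
      push_cast
      ring
    by_cases hkj : k = j
    · rw [hkj, hej, ← hy]
      simp only [map_sub, map_smul, hPj, inner_sub_left, inner_sub_right, inner_smul_left,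
        inner_smul_right, h11, h12, hfji, hfjj, RCLike.conj_ofReal]
      push_cast
      ring
    · rw [hek k hki hkj, hdiag k, hd'k k hki hkj]

/-! ### Limits of projections -/

/-- A pointwise limit of diagonals of projections is the diagonal of a projection, provided that
the distances of the entries to `{0,1}` are dominated by a summable family. -/
theorem exists_projection_of_tendsto [CompleteSpace H] {α : Type*} {l : Filter α} [l.NeBot]
    (e : HilbertBasis I 𝕜 H) {d : I → ℝ} {D : α → I → ℝ} {C : I → ℝ} (hC : Summable C)
    (hC0 : ∀ j, 0 ≤ C j)
    (hP : ∀ᶠ a in l, ∃ P : H →L[𝕜] H, IsStarProjection P ∧ HasDiagonal e P (D a))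
    (hD : ∀ i, Tendsto (fun a => D a i) l (𝓝 (d i)))
    (hDC : ∀ᶠ a in l, ∀ j, D a j ≤ C j ∨ 1 - D a j ≤ C j) :
    ∃ P : H →L[𝕜] H, IsStarProjection P ∧ HasDiagonal e P d := by
  classical
  obtain ⟨P, hP⟩ := hP.choice
  -- Along an ultrafilter all bounded matrix entries converge at once, whatever the cardinality of
  -- `I`.
  set u : Ultrafilter α := Ultrafilter.of l
  have hu : (u : Filter α) ≤ l := Ultrafilter.of_le l
  -- The diagonal entry of a column is bounded only by `1`, hence the extra term.
  set B : I → I → ℝ := fun i j => C j + if j = i then 1 else 0 with hB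
  have hBsum : ∀ i, Summable (B i) := fun i =>
    hC.add (summable_of_ne_finset_zero (s := {i}) fun j hj => by simpa using hj)
  have hbound : ∀ᶠ a in (u : Filter α), ∀ i j, ‖(inner 𝕜 (e j) (P a (e i)) : 𝕜)‖ ^ 2 ≤ B i j := by
    filter_upwards [hu hP, hu hDC] with a ⟨h1, h2⟩ h3 i j
    by_cases hji : j = i
    · subst hji
      have h4 := h1.norm_inner_sq_le (h2 j) (e.orthonormal.1 j)
      have h5 : D a j ≤ 1 := by
        have h6 := h1.one_sub.norm_apply_sq (x := e j) (r := 1 - D a j)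
          (by simp [inner_sub_left, h2 j, inner_self_eq_norm_sq_to_K, e.orthonormal.1 j])
        nlinarith [sq_nonneg ‖(1 - P a) (e j)‖]
      simp only [hB, if_true]
      linarith [hC0 j]
    · simpa [hB, hji] using h2.norm_entry_sq_le h1 hji (h3 j)
  have hlim : ∀ i j, ∃ p : 𝕜, Tendsto (fun a => (inner 𝕜 (e j) (P a (e i)) : 𝕜)) u (𝓝 p) := by
    intro i j
    have hmem : ∀ᶠ a in (u : Filter α),
        (inner 𝕜 (e j) (P a (e i)) : 𝕜) ∈ Metric.closedBall (0 : 𝕜) (√(B i j)) := by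
      filter_upwards [hbound] with a ha
      rw [mem_closedBall_zero_iff]
      exact Real.le_sqrt_of_sq_le (ha i j)
    obtain ⟨p, -, hp⟩ := (isCompact_closedBall (0 : 𝕜) (√(B i j))).ultrafilter_le_nhds
      (u.map fun a => (inner 𝕜 (e j) (P a (e i)) : 𝕜)) (le_principal_iff.2 hmem)
    exact ⟨p, hp⟩
  choose p hp using hlim
  have hpB : ∀ i j, ‖p i j‖ ^ 2 ≤ B i j := fun i j =>
    le_of_tendsto ((hp i j).norm.pow 2) (hbound.mono fun a ha => ha i j)
  have hmem : ∀ i, Memℓp (p i) 2 := fun i => by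
    refine memℓp_gen ?_
    simpa using Summable.of_nonneg_of_le (fun j => sq_nonneg _) (hpB i) (hBsum i)
  set v : I → H := fun i => e.repr.symm ⟨p i, hmem i⟩ with hv
  have hev : ∀ i j, inner 𝕜 (e j) (v i) = p i j := fun i j => by
    rw [← e.repr_apply_apply, hv]
    simp
  obtain ⟨Q, hQ, hQv⟩ := exists_isStarProjection_of_gram e v (by
    intro i k
    rw [hev, ← e.tsum_inner_mul_inner]
    -- Parseval turns the Gram relation into a sum over `j`, whose terms are dominated by `B i j + B
    -- k j`.
    have h1 : Tendsto (fun a => ∑' j, inner 𝕜 (P a (e i)) (e j) * inner 𝕜 (e j) (P a (e k))) u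
        (𝓝 (∑' j, inner 𝕜 (v i) (e j) * inner 𝕜 (e j) (v k))) := by
      refine tendsto_tsum_of_dominated_convergence ((hBsum i).add (hBsum k)) (fun j => ?_) ?_
      · rw [hev, ← inner_conj_symm, hev]
        refine Tendsto.mul ?_ (hp k j)
        have := (RCLike.continuous_conj (K := 𝕜)).continuousAt.tendsto.comp (hp i j)
        refine this.congr fun a => ?_
        exact inner_conj_symm _ _
      · filter_upwards [hbound] with a ha j
        rw [norm_mul, norm_inner_symm]
        nlinarith [ha i j, ha k j, sq_nonneg (‖(inner 𝕜 (e j) (P a (e i)) : 𝕜)‖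
          - ‖(inner 𝕜 (e j) (P a (e k)) : 𝕜)‖),
          sq_nonneg ‖(inner 𝕜 (e j) (P a (e i)) : 𝕜)‖, sq_nonneg ‖(inner 𝕜 (e j) (P a (e k)) : 𝕜)‖]
    refine tendsto_nhds_unique h1 ((hp k i).congr' ?_)
    filter_upwards [hu hP] with a ha
    rw [e.tsum_inner_mul_inner, ← ha.1.inner_apply_eq, ← inner_conj_symm, ha.1.inner_apply_eq,
      inner_conj_symm, ← ha.1.inner_apply_eq])
  refine ⟨Q, hQ, fun i => ?_⟩
  rw [hQv, ← inner_conj_symm, hev]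
  have h1 : Tendsto (fun a => (inner 𝕜 (e i) (P a (e i)) : 𝕜)) u (𝓝 (d i : 𝕜)) := by
    refine Tendsto.congr' ?_
      ((RCLike.continuous_ofReal (K := 𝕜)).continuousAt.tendsto.comp ((hD i).mono_left hu))
    filter_upwards [hu hP] with a ha
    rw [← inner_conj_symm, ha.2 i]
    simp
  rw [tendsto_nhds_unique (hp i i) h1, RCLike.conj_ofReal]

end Projections

/-! ### Finite approximations of the diagonal -/

theorem theorem3p3 {𝕜 : Type*} [RCLike 𝕜] {I : Type*} {H : Type*} [NormedAddCommGroup H]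
    [InnerProductSpace 𝕜 H] [CompleteSpace H] (e : HilbertBasis I 𝕜 H)
    (d : I → ℝ) (hd : ∀ i, d i ∈ Set.Icc (0 : ℝ) 1) (a b : ℝ)
    (ha : HasSum (fun i : {i : I // d i < 1 / 2} => d i) a)
    (hb : HasSum (fun i : {i : I // 1 / 2 ≤ d i} => 1 - d i) b)
    (hab : ∃ n : ℤ, a - b = n) :
    ∃ P : H →L[𝕜] H, IsStarProjection P ∧ HasDiagonal e P d := by
  classical
  by_cases h01 : ∀ i, d i = 0 ∨ d i = 1
  · exact exists_projection_of_zero_one e d h01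
  push Not at h01
  obtain ⟨i₀, hi0, hi1⟩ := h01
  obtain ⟨n, hn⟩ := hab
  have hA : HasSum (Set.indicator {i | d i < 1 / 2} d) a :=
    (hasSum_subtype_iff_indicator (s := {i | d i < 1 / 2})).1 ha
  have hB : HasSum (Set.indicator {i | 1 / 2 ≤ d i} fun i => 1 - d i) b :=
    (hasSum_subtype_iff_indicator (f := fun i => 1 - d i) (s := {i | 1 / 2 ≤ d i})).1 hb
  -- `r` rounds `d` to `{0,1}`, and `d - r` has sum `a - b`
  set r : I → ℝ := fun i => if d i < 1 / 2 then 0 else 1 with hr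
  have hg : HasSum (fun i => d i - r i) n := by
    rw [← hn]
    refine (hA.sub hB).congr_fun fun i => ?_
    by_cases h : d i < 1 / 2
    · simp only [hr, Set.indicator, Set.mem_ofPred_eq, if_pos h, if_neg (not_le.2 h)]
    · simp only [hr, Set.indicator, Set.mem_ofPred_eq, if_neg h, if_pos (not_lt.1 h)]
      ring
  -- For `i₀ ∈ F` the correction makes the sum over `F` equal to `n + ∑ k ∈ F, r k`. It is small for
  -- large `F`, so `0 < d i₀ < 1` keeps the entry at `i₀` in `[0,1]`.
  set D : Finset I → I → ℝ := fun F i =>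
    (if i ∈ F then d i else r i) + if i = i₀ then n - ∑ k ∈ F, (d k - r k) else 0 with hD
  -- The extra `1` covers the corrected entry at `i₀`, which is only known to be at most `1`.
  set C : I → ℝ := fun j => |d j - r j| + if j = i₀ then 1 else 0 with hC
  have herr : Tendsto (fun F : Finset I => (n : ℝ) - ∑ k ∈ F, (d k - r k)) atTop (𝓝 0) := by
    rw [← sub_self (n : ℝ)]
    exact tendsto_const_nhds.sub hg
  have hDlim : ∀ i, Tendsto (fun F => D F i) atTop (𝓝 (d i)) := by
    intro i
    have h1 : Tendsto (fun F : Finset I => d i +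
        if i = i₀ then (n : ℝ) - ∑ k ∈ F, (d k - r k) else 0) atTop (𝓝 (d i)) := by
      split_ifs
      · simpa using tendsto_const_nhds.add herr
      · simp
    refine h1.congr' ?_
    filter_upwards [eventually_ge_atTop {i}] with F hF
    simp [hD, singleton_subset_iff.1 hF]
  have hr01 : ∀ i, r i = 0 ∨ r i = 1 := fun i => by
    simp only [hr]
    split_ifs <;> simp
  have hDi₀ : ∀ᶠ F in atTop, D F i₀ ∈ Set.Icc (0 : ℝ) 1 :=
    (hDlim i₀).eventually (Icc_mem_nhds (lt_of_le_of_ne (hd i₀).1 hi0.symm)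
      (lt_of_le_of_ne (hd i₀).2 hi1))
  have hDne : ∀ F i, i ≠ i₀ → D F i = if i ∈ F then d i else r i := fun F i h => by
    simp [hD, h]
  refine exists_projection_of_tendsto (l := atTop) (D := D) (C := C) e ?_ ?_ ?_ hDlim ?_
  · exact hg.summable.abs.add
      (summable_of_ne_finset_zero (s := {i₀}) fun j hj => by simpa using hj)
  · intro j
    simp only [hC]
    positivity
  · filter_upwards [hDi₀, eventually_ge_atTop {i₀}] with F hF hi₀F
    have hi₀F : i₀ ∈ F := singleton_subset_iff.1 hi₀F
    refine exists_projection_of_finset F e (D F) (fun i => ?_) (fun i hi => ?_) ?_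
    · by_cases h : i = i₀
      · rwa [h]
      · rw [hDne F i h]
        split_ifs
        · exact hd i
        · rcases hr01 i with h | h <;> simp [h]
    · rw [hDne F i fun h => hi (h ▸ hi₀F), if_neg hi]
      exact hr01 i
    · refine ⟨n + ∑ i ∈ F, if d i < 1 / 2 then 0 else 1, ?_⟩
      have h1 : ∑ i ∈ F, (if i ∈ F then d i else r i) = ∑ i ∈ F, d i :=
        sum_congr rfl fun i hi => if_pos hi
      simp only [hD]
      rw [sum_add_distrib, h1, sum_ite_eq' F i₀, if_pos hi₀F, sum_sub_distrib]
      push_cast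
      simp only [hr]
      ring
  · filter_upwards [hDi₀] with F hF j
    by_cases h : j = i₀
    · subst h
      left
      simp only [hC, if_true]
      linarith [hF.2, abs_nonneg (d j - r j)]
    · rw [hDne F j h]
      simp only [hC, if_neg h, add_zero]
      have hdj := hd j
      split_ifs
      · rcases hr01 j with h | h
        · left
          rw [h, sub_zero]
          exact le_abs_self _
        · right
          rw [h, abs_sub_comm]
          exact le_abs_self _
      · rcases hr01 j with h | h
        · left
          rw [h]
          positivity
        · right
          rw [h, sub_self]
          positivity
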